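/- Let $\mathcal H$ be a complex Hilbert space of finite dimension $d$. A state on $\mathcal H$ is a positive semidefinite operator of unit trace. Logarithms are to base $2$, with $0\log 0=0$. For states $\rho,\sigma$ write $S(\rho)=-\mathrm{Tr}(\rho\log\rho)$ for the von Neumann entropy, $T(\rho,\sigma)=\tfrac12\mathrm{Tr}|\rho-\sigma|$ for the trace distance, where $|A|=\sqrt{A^\dagger A}$, and $\|\cdot\|_\infty$ for the operator norm. Let $h(\varepsilon)=-\varepsilon\log\varepsilon-(1-\varepsilon)\log(1-\varepsilon)$ denote the binary entropy. (i) Let $\rho,\sigma$ be states on $\mathcal H$ and let $\varepsilon,\nu\in[0,1]$ satisfy $T(\rho,\sigma)\le\varepsilon$, $\|\rho-\sigma\|_\infty\le\nu$ and $\varepsilon\le \nu d/(\nu d+3)$. Then, with $\beta:=\nu/\varepsilon$, $$|S(\rho)-S(\sigma)|\le \varepsilon\log(\beta d-1)+h(\varepsilon),$$ where the right-hand side is read as $0$ if $\varepsilon=0$. (ii) The bound is tight when $1/\beta$ is an integer: for all $\varepsilon\in(0,1]$ and $\nu\in[0,1]$ with $\varepsilon\le\nu d/(\nu d+3)$ such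 that $1/\beta=\varepsilon/\nu$ is an integer, there exist states $\rho,\sigma$ on $\mathcal H$ with $T(\rho,\sigma)=\varepsilon$, $\|\rho-\sigma\|_\infty=\nu$ and $$|S(\rho)-S(\sigma)|= \varepsilon\log(\beta d-1)+h(\varepsilon).$$ -/

import Mathlib

noncomputable section

namespace QEntropy

variable {H : Type*} [NormedAddCommGroup H] [InnerProductSpace ℂ H] [CompleteSpace H]

/-- The trace of an operator on a finite-dimensional Hilbert space. -/
def trace (A : H →L[ℂ] H) : ℂ := LinearMap.trace ℂ H (A : H →ₗ[ℂ] H)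

/-- A state (density matrix): a positive semidefinite operator of unit trace. -/
structure IsState (ρ : H →L[ℂ] H) : Prop where
  isPositive : ρ.IsPositive
  trace_eq_one : trace ρ = 1

/-- The trace norm `‖A‖₁ = Tr |A|`, where `|A| = √(A† A)`. -/
def traceNorm (A : H →L[ℂ] H) : ℝ := (trace (CFC.abs A)).re

/-- The trace distance `T(ρ, σ) = ½ ‖ρ - σ‖₁`. -/
def traceDist (ρ σ : H →L[ℂ] H) : ℝ := 1 / 2 * traceNorm (ρ - σ)

/-- The von Neumann entropy `S(ρ) = - Tr (ρ log ρ)`, with logarithm to base 2.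
The logarithm of an operator is taken by functional calculus; as `Real.logb 2 0 = 0`, zero
eigenvalues contribute `0 log 0 = 0`. -/
def vonNeumannEntropy (ρ : H →L[ℂ] H) : ℝ := -(trace (ρ * cfc (Real.logb 2) ρ)).re

/-- The binary entropy `h(ε) = - ε log ε - (1 - ε) log (1 - ε)`, with logarithm to base 2. -/
def binaryEntropy (ε : ℝ) : ℝ := -ε * Real.logb 2 ε - (1 - ε) * Real.logb 2 (1 - ε)

end QEntropy

end

namespace QEntropy

open Real Finset

/-! ### Entropy bounds for probability vectors -/

/-! The problem reduces to probability vectors. Pairing the eigenvalues of `ρ` and `σ` in decreasing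
order increases neither distance: Weyl's inequality (`eigenvalues_le_add`) covers the operator norm,
Mirsky's (`sum_abs_eigenvalues_sub_le_traceNorm`) the trace norm. Entropies depend on eigenvalues
only.

For vectors `p`, `q` at trace distance exactly `t`, let `a` and `b` be the positive parts of `p - q`
and `q - p`, each of mass `t`. Writing `H` for the sum of `negMulLog`, subadditivity where `q ≤ p`
and Gibbs' inequality where `p ≤ q` give `H(p) - H(q) ≤ H(a) - H(b) + h(t)`. As `b ≤ ν`, `H(b) ≥ -t
log ν`, and `b` occupies at least `t/ν` indices. At most `d - t/ν` remain for `a`, so `H(a) ≤ t log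
((d - t/ν)/t)`. The sum of these bounds is `t log (νd/t - 1) + h(t)` (`sum_negMulLog_sub_le`), which
increases in `t` up to `νd/(νd + 3)`, so `t` may be replaced by `ε`.

For tightness, a uniform `σ` of rank `ε/ν` that loses mass `ε` evenly to its orthogonal complement
makes every step an equality. -/

lemma negMulLog_le_sub_sub_mul_log {x z : ℝ} (hx : 0 ≤ x) (hz : 0 < z) :
    negMulLog x ≤ z - x - x * log z := by
  rcases hx.eq_or_lt with rfl | hx
  · simpa using hz.le
  · have h := mul_le_mul_of_nonneg_left (log_le_sub_one_of_pos (div_pos hz hx)) hx.le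
    rw [log_div hz.ne' hx.ne', mul_sub, mul_sub, mul_div_cancel₀ _ hx.ne'] at h
    simp only [negMulLog]
    linarith

lemma negMulLog_add_le {x y : ℝ} (hx : 0 ≤ x) (hy : 0 ≤ y) :
    negMulLog (x + y) ≤ negMulLog x + negMulLog y := by
  have key : ∀ {x y : ℝ}, 0 ≤ x → 0 ≤ y → x * log x ≤ x * log (x + y) := by
    intro x y hx hy
    rcases hx.eq_or_lt with rfl | hx
    · simp
    · exact mul_le_mul_of_nonneg_left (log_le_log hx (by linarith)) hx.le
  have h1 := key hx hy
  have h2 := key hy hx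
  rw [add_comm y x] at h2
  simp only [negMulLog]
  linarith

/-- Gibbs' inequality: the cost of splitting mass `x + y` into `x` and `y` is least when coded by
the true proportions, so coding by `(t, 1 - t)` can only raise it. -/
lemma negMulLog_add_negMulLog_sub_le {x y t : ℝ} (hx : 0 ≤ x) (hy : 0 ≤ y) (ht : 0 < t)
    (ht1 : t < 1) :
    negMulLog x + negMulLog y - negMulLog (x + y) ≤ -x * log t - y * log (1 - t) := by
  rcases (add_nonneg hx hy).eq_or_lt with h | h
  · obtain rfl : x = 0 := by linarith
    obtain rfl : y = 0 := by linarith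
    simp
  · have h1t : 0 < 1 - t := by linarith
    have h1 := negMulLog_le_sub_sub_mul_log hx (mul_pos h ht)
    have h2 := negMulLog_le_sub_sub_mul_log hy (mul_pos h h1t)
    rw [log_mul h.ne' ht.ne'] at h1
    rw [log_mul h.ne' h1t.ne'] at h2
    have h3 : negMulLog (x + y) = -(x + y) * log (x + y) := rfl
    rw [h3]
    nlinarith

/-- Pointwise form of the entropy difference bound, in terms of the positive parts of `p - q` and
`q - p`. -/
lemma negMulLog_sub_negMulLog_le {p q t : ℝ} (hp : 0 ≤ p) (hq : 0 ≤ q) (ht : 0 < t)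
    (ht1 : t < 1) :
    negMulLog p - negMulLog q ≤ negMulLog (max (p - q) 0) - negMulLog (max (q - p) 0)
      - max (q - p) 0 * log t - (q - max (q - p) 0) * log (1 - t) := by
  rcases le_total q p with h | h
  · rw [max_eq_left (by linarith), max_eq_right (by linarith)]
    have h1 := negMulLog_add_le hq (sub_nonneg.2 h)
    have h2 : log (1 - t) ≤ 0 := log_nonpos (by linarith) (by linarith)
    rw [add_sub_cancel] at h1
    simp only [negMulLog_zero]
    nlinarith
  · rw [max_eq_right (by linarith), max_eq_left (by linarith)]
    have h1 := negMulLog_add_negMulLog_sub_le (sub_nonneg.2 h) hp ht ht1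
    rw [sub_add_cancel] at h1
    simp only [negMulLog_zero, sub_sub_cancel]
    linarith

theorem sum_negMulLog_sub_le {ι : Type*} [Fintype ι] {p q : ι → ℝ} {t ν : ℝ}
    (hp : ∀ i, 0 ≤ p i) (hq : ∀ i, 0 ≤ q i) (hp1 : ∑ i, p i = 1) (hq1 : ∑ i, q i = 1)
    (hν : ∀ i, |p i - q i| ≤ ν) (ht : ∑ i, |p i - q i| = 2 * t) (ht0 : 0 < t) (ht1 : t < 1)
    (hν0 : 0 < ν) (htν : t < ν * Fintype.card ι) :
    ∑ i, negMulLog (p i) - ∑ i, negMulLog (q i) ≤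
      t * log (ν * Fintype.card ι / t - 1) + binEntropy t := by
  classical
  set a : ι → ℝ := fun i => max (p i - q i) 0 with ha
  set b : ι → ℝ := fun i => max (q i - p i) 0 with hb
  have hab : ∀ i, a i + b i = |p i - q i| ∧ a i - b i = p i - q i ∧ 0 ≤ a i ∧ 0 ≤ b i ∧
      (0 < a i → b i = 0) := by
    intro i
    simp only [ha, hb]
    rcases le_total (q i) (p i) with h | h
    · rw [max_eq_left (by linarith), max_eq_right (by linarith), abs_of_nonneg (by linarith)]
      exact ⟨by ring, by ring, by linarith, le_rfl, fun _ => rfl⟩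
    · rw [max_eq_right (by linarith), max_eq_left (by linarith), abs_of_nonpos (by linarith)]
      exact ⟨by ring, by ring, le_rfl, by linarith, fun h => absurd h (lt_irrefl _)⟩
  have hs1 : ∑ i, a i + ∑ i, b i = 2 * t := by
    rw [← sum_add_distrib, ← ht]
    exact sum_congr rfl fun i _ => (hab i).1
  have hs2 : ∑ i, a i - ∑ i, b i = 0 := by
    rw [← sum_sub_distrib, sum_congr rfl fun i _ => (hab i).2.1, sum_sub_distrib, hp1, hq1,
      sub_self]
  have hsa : ∑ i, a i = t := by linarith
  have hsb : ∑ i, b i = t := by linarith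
  have hbν : ∀ i, b i ≤ ν := fun i => by linarith [(hab i).1, (hab i).2.2.1, hν i]
  set A := univ.filter fun i => 0 < a i with hA
  set n : ℝ := (Fintype.card ι : ℝ) with hn
  -- The mass `t` of `b` lives off the support `A` of `a`, at most `ν` per index.
  have hcard : t ≤ ν * (n - #A) := by
    have h1 : ∑ i, b i ≤ ∑ i ∈ univ \ A, ν := by
      rw [← sum_sdiff (subset_univ A)]
      have h2 : ∑ i ∈ A, b i = 0 := sum_eq_zero fun i hi => (hab i).2.2.2.2 (by simpa [hA] using hi)
      rw [h2, add_zero]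
      exact sum_le_sum fun i _ => hbν i
    rw [sum_const, card_sdiff_of_subset (subset_univ A), nsmul_eq_mul,
      Nat.cast_sub (card_le_card (subset_univ A)), card_univ, hsb] at h1
    linarith
  set K : ℝ := n - t / ν with hK
  have hK0 : 0 < K := by
    rw [hK, sub_pos, div_lt_iff₀ hν0]; linarith
  have hAK : (#A : ℝ) ≤ K := by
    have : t / ν ≤ n - #A := by rw [div_le_iff₀ hν0]; linarith
    linarith
  -- Tangent line of `negMulLog` at `t / K`, the value of mass `t` spread evenly over `K` points;
  -- `K` need not be an integer.
  have hEa : ∑ i, negMulLog (a i) ≤ -t * log (t / K) := by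
    have hz : 0 < t / K := div_pos ht0 hK0
    have h1 : ∀ i, negMulLog (a i) ≤ (if 0 < a i then t / K else 0) - a i - a i * log (t / K) := by
      intro i
      split_ifs with h
      · exact negMulLog_le_sub_sub_mul_log h.le hz
      · have : a i = 0 := le_antisymm (not_lt.1 h) (hab i).2.2.1
        simp [this]
    refine (sum_le_sum fun i _ => h1 i).trans ?_
    rw [sum_sub_distrib, sum_sub_distrib, ← sum_mul, hsa, ← sum_filter, ← hA, sum_const,
      nsmul_eq_mul]
    have h2 : (#A : ℝ) * (t / K) ≤ t := by
      calc (#A : ℝ) * (t / K) ≤ K * (t / K) := by gcongr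
        _ = t := mul_div_cancel₀ _ hK0.ne'
    linarith
  have hEb : -t * log ν ≤ ∑ i, negMulLog (b i) := by
    rw [← hsb, neg_mul, sum_mul, ← sum_neg_distrib]
    refine sum_le_sum fun i _ => ?_
    rcases (hab i).2.2.2.1.eq_or_lt with h | h
    · simp [← h]
    · have := mul_le_mul_of_nonneg_left (log_le_log h (hbν i)) h.le
      simp only [negMulLog]
      linarith
  have hmain : ∑ i, negMulLog (p i) - ∑ i, negMulLog (q i) ≤
      ∑ i, negMulLog (a i) - ∑ i, negMulLog (b i) - t * log t - (1 - t) * log (1 - t) := by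
    rw [← sum_sub_distrib]
    refine (sum_le_sum fun i _ => negMulLog_sub_negMulLog_le (hp i) (hq i) ht0 ht1).trans ?_
    rw [sum_sub_distrib, sum_sub_distrib, sum_sub_distrib, ← sum_mul, ← sum_mul, sum_sub_distrib,
      hq1, hsb]
  have hlog : log (ν * n / t - 1) = log ν - log (t / K) := by
    rw [← log_div hν0.ne' (div_pos ht0 hK0).ne', hK]
    congr 1
    field_simp
  have hbin : binEntropy t = -t * log t - (1 - t) * log (1 - t) := by
    rw [binEntropy_eq_negMulLog_add_negMulLog_one_sub, negMulLog, negMulLog]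
    ring
  rw [hlog, hbin]
  linarith

/-- The derivative is nonnegative wherever `3 * x ≤ a * (1 - x)`, which is the condition `x ≤ a / (a
+ 3)`. -/
lemma mul_log_div_sub_one_add_binEntropy_mono {a t ε : ℝ} (ha : 0 ≤ a) (ht : 0 < t) (htε : t ≤ ε)
    (hε : ε ≤ a / (a + 3)) :
    t * log (a / t - 1) + binEntropy t ≤ ε * log (a / ε - 1) + binEntropy ε := by
  have hrange : ∀ x ∈ Set.Icc t ε, 0 < x ∧ x < 1 ∧ 3 * x ≤ a * (1 - x) ∧ x < a := by
    rintro x ⟨h1, h2⟩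
    have h3 : x * (a + 3) ≤ a := by
      have := h2.trans hε
      rwa [le_div_iff₀ (by linarith)] at this
    have hx : 0 < x := ht.trans_le h1
    have hx1 : x < 1 := by nlinarith
    refine ⟨hx, hx1, by linarith, ?_⟩
    nlinarith
  have hder : ∀ x ∈ Set.Icc t ε, HasDerivAt (fun y => y * log (a - y) + negMulLog y + binEntropy y)
      (log (a - x) - x / (a - x) - log x - 1 + (log (1 - x) - log x)) x := by
    intro x hx
    obtain ⟨h0, h1, -, h3⟩ := hrange x hx
    have hsub : a - x ≠ 0 := by linarith
    have e1 := (hasDerivAt_id x).mul (((hasDerivAt_const x a).sub (hasDerivAt_id x)).log hsub)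
    have e := (e1.add (hasDerivAt_negMulLog h0.ne')).add (hasDerivAt_binEntropy h0.ne' h1.ne)
    convert! e using 1
    simp
    ring
  have hmono : MonotoneOn (fun y => y * log (a - y) + negMulLog y + binEntropy y)
      (Set.Icc t ε) := by
    refine monotoneOn_of_deriv_nonneg (convex_Icc t ε)
      (fun x hx => (hder x hx).continuousAt.continuousWithinAt)
      (fun x hx => (hder x (interior_subset hx)).differentiableAt.differentiableWithinAt) ?_
    intro x hx
    rw [(hder x (interior_subset hx)).deriv]
    obtain ⟨h0, h1, h2, h3⟩ := hrange x (interior_subset hx)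
    have hax : 0 < a - x := by linarith
    have h1x : 0 < 1 - x := by linarith
    -- The logarithms in the derivative are thus at least `log (1 + 2 / x) ≥ 2 / (x + 1)`, while the
    -- subtracted terms are at most `3 / (2 + x)`; these compare correctly because `x ≤ 1`.
    have hlow : x * (2 + x) ≤ (a - x) * (1 - x) := by nlinarith
    have hlog : log (1 + 2 / x) ≤ log (a - x) + log (1 - x) - log x - log x := by
      rw [← log_mul hax.ne' h1x.ne', ← log_div (by positivity) h0.ne',
        ← log_div (by positivity) h0.ne']
      refine log_le_log (by positivity) ?_
      rw [le_div_iff₀ h0, le_div_iff₀ h0]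
      have : (1 + 2 / x) * x * x = x * (2 + x) := by field_simp; ring
      linarith
    have hlog2 : 2 / (x + 1) ≤ log (1 + 2 / x) := by
      refine le_trans (le_of_eq ?_) (le_log_one_add_of_nonneg (by positivity : 0 ≤ 2 / x))
      field_simp
      ring
    have hfrac : x / (a - x) ≤ (1 - x) / (2 + x) := by
      rw [div_le_div_iff₀ hax (by linarith)]; linarith
    have hfin : 1 + (1 - x) / (2 + x) ≤ 2 / (x + 1) := by
      rw [← sub_nonneg]
      have : 2 / (x + 1) - (1 + (1 - x) / (2 + x)) = (1 - x) / ((x + 1) * (2 + x)) := by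
        field_simp; ring
      rw [this]; positivity
    linarith
  have heq : ∀ x ∈ Set.Icc t ε,
      x * log (a / x - 1) + binEntropy x = x * log (a - x) + negMulLog x + binEntropy x := by
    intro x hx
    obtain ⟨h0, -, -, h3⟩ := hrange x hx
    have : a / x - 1 = (a - x) / x := by field_simp
    rw [this, log_div (by linarith) h0.ne', negMulLog]
    ring
  have hl : t ∈ Set.Icc t ε := ⟨le_rfl, htε⟩
  have hr : ε ∈ Set.Icc t ε := ⟨htε, le_rfl⟩
  rw [heq t hl, heq ε hr]
  exact hmono hl hr htε

/-- The entropy continuity bound for probability vectors. -/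
theorem abs_sum_negMulLog_sub_le {ι : Type*} [Fintype ι] {p q : ι → ℝ} {ε ν : ℝ}
    (hp : ∀ i, 0 ≤ p i) (hq : ∀ i, 0 ≤ q i) (hp1 : ∑ i, p i = 1) (hq1 : ∑ i, q i = 1)
    (hν : ∀ i, |p i - q i| ≤ ν) (hsum : ∑ i, |p i - q i| ≤ 2 * ε) (hε0 : 0 ≤ ε) (hν0 : 0 ≤ ν)
    (hε : ε ≤ ν * Fintype.card ι / (ν * Fintype.card ι + 3)) :
    |∑ i, negMulLog (p i) - ∑ i, negMulLog (q i)| ≤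
      ε * log (ν / ε * Fintype.card ι - 1) + binEntropy ε := by
  have ha : 0 ≤ ν * Fintype.card ι := by positivity
  have hεa : ε * (ν * Fintype.card ι + 3) ≤ ν * Fintype.card ι := by
    rwa [le_div_iff₀ (by linarith)] at hε
  have hε1 : ε < 1 := by nlinarith
  set t : ℝ := (∑ i, |p i - q i|) / 2 with ht
  have ht0 : 0 ≤ t := div_nonneg (sum_nonneg fun i _ => abs_nonneg _) zero_le_two
  have htε : t ≤ ε := by linarith
  rcases ht0.eq_or_lt with h | h
  -- At distance zero only nonnegativity of the bound remains; for `ε > 0` it follows from `ν * d /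
  -- ε ≥ 3`.
  · have hpq : p = q := by
      have h0 : ∑ i, |p i - q i| = 0 := by linarith
      funext i
      have := (sum_eq_zero_iff_of_nonneg fun i _ => abs_nonneg _).1 h0 i (mem_univ i)
      exact sub_eq_zero.1 (abs_eq_zero.1 this)
    rw [hpq, sub_self, abs_zero]
    refine add_nonneg ?_ (binEntropy_nonneg hε0 hε1.le)
    rcases hε0.eq_or_lt with h0 | h0
    · simp [← h0]
    · refine mul_nonneg hε0 (log_nonneg ?_)
      have : 3 ≤ ν / ε * Fintype.card ι := by
        rw [div_mul_eq_mul_div, le_div_iff₀ h0]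
        nlinarith
      linarith
  · have hνpos : 0 < ν := by
      rcases hν0.eq_or_lt with h0 | h0
      · rw [← h0] at hεa; linarith
      · exact h0
    have hmono := mul_log_div_sub_one_add_binEntropy_mono ha h htε hε
    rw [div_mul_eq_mul_div]
    refine le_trans ?_ hmono
    have hta : t < ν * Fintype.card ι := by nlinarith
    have hν' : ∀ i, |q i - p i| ≤ ν := fun i => abs_sub_comm (p i) (q i) ▸ hν i
    have hsum2 : ∑ i, |p i - q i| = 2 * t := by linarith
    have hsum' : ∑ i, |q i - p i| = 2 * t := by
      rw [← hsum2]; exact sum_congr rfl fun i _ => abs_sub_comm _ _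
    rw [abs_le']
    constructor
    · exact sum_negMulLog_sub_le hp hq hp1 hq1 hν hsum2 h (htε.trans_lt hε1) hνpos hta
    · rw [neg_sub]
      exact sum_negMulLog_sub_le hq hp hq1 hp1 hν' hsum' h (htε.trans_lt hε1) hνpos hta

section

variable {H : Type*} [NormedAddCommGroup H] [InnerProductSpace ℂ H]

/-! ### Sorted eigenvalues -/

section Eigenvalues

variable [FiniteDimensional ℂ H] {d : ℕ}

lemma re_inner_apply_self_eq_sum {A : H →ₗ[ℂ] H} (hA : A.IsSymmetric)
    (hd : Module.finrank ℂ H = d) (x : H) :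
    (inner ℂ (A x) x).re =
      ∑ i, hA.eigenvalues hd i * ‖inner ℂ (hA.eigenvectorBasis hd i) x‖ ^ 2 := by
  rw [← (hA.eigenvectorBasis hd).sum_inner_mul_inner, Complex.re_sum]
  refine sum_congr rfl fun i _ => ?_
  rw [hA, hA.apply_eigenvectorBasis hd, inner_smul_right, mul_assoc,
    ← inner_conj_symm x, Complex.conj_mul']
  simp [← Complex.ofReal_pow]

/-- Weyl's inequality for the sorted eigenvalues. -/
theorem eigenvalues_le_add {A B : H →ₗ[ℂ] H} (hA : A.IsSymmetric) (hB : B.IsSymmetric)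
    (hd : Module.finrank ℂ H = d) {c : ℝ}
    (h : ∀ x, (inner ℂ (A x) x).re ≤ (inner ℂ (B x) x).re + c * ‖x‖ ^ 2) (i : Fin d) :
    hA.eigenvalues hd i ≤ hB.eigenvalues hd i + c := by
  classical
  -- These `d - 1` conditions leave a nonzero `x` orthogonal to the eigenvectors of `A` after `i`
  -- and of `B` before `i`; its quadratic forms separate the two `i`-th eigenvalues.
  let f : H →ₗ[ℂ] ({j : Fin d // j ≠ i} → ℂ) := LinearMap.pi fun j =>
    if i < j then (innerSL ℂ (hA.eigenvectorBasis hd j) : H →ₗ[ℂ] ℂ)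
    else (innerSL ℂ (hB.eigenvectorBasis hd j) : H →ₗ[ℂ] ℂ)
  have hf : LinearMap.ker f ≠ ⊥ := by
    apply LinearMap.ker_ne_bot_of_finrank_lt
    have := i.pos
    simp [hd, Fintype.card_subtype_compl]
    omega
  obtain ⟨x, hx, hx0⟩ := (Submodule.ne_bot_iff _).1 hf
  have hxj : ∀ j (hj : j ≠ i), f x ⟨j, hj⟩ = 0 := fun j hj => by
    rw [LinearMap.mem_ker.1 hx]; rfl
  have hxA : ∀ j, i < j → inner ℂ (hA.eigenvectorBasis hd j) x = 0 := fun j hj => by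
    simpa [f, hj] using hxj j hj.ne'
  have hxB : ∀ j, j < i → inner ℂ (hB.eigenvectorBasis hd j) x = 0 := fun j hj => by
    simpa [f, hj.not_gt] using hxj j hj.ne
  have h1 : hA.eigenvalues hd i * ‖x‖ ^ 2 ≤ (inner ℂ (A x) x).re := by
    rw [re_inner_apply_self_eq_sum hA hd, ← (hA.eigenvectorBasis hd).sum_sq_norm_inner_right x,
      mul_sum]
    refine sum_le_sum fun j _ => ?_
    rcases lt_or_ge i j with hj | hj
    · simp [hxA j hj]
    · exact mul_le_mul_of_nonneg_right (hA.eigenvalues_antitone hd hj) (by positivity)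
  have h2 : (inner ℂ (B x) x).re ≤ hB.eigenvalues hd i * ‖x‖ ^ 2 := by
    rw [re_inner_apply_self_eq_sum hB hd, ← (hB.eigenvectorBasis hd).sum_sq_norm_inner_right x,
      mul_sum]
    refine sum_le_sum fun j _ => ?_
    rcases lt_or_ge j i with hj | hj
    · simp [hxB j hj]
    · exact mul_le_mul_of_nonneg_right (hB.eigenvalues_antitone hd hj) (by positivity)
  have hpos : 0 < ‖x‖ ^ 2 := by positivity
  refine le_of_mul_le_mul_right ?_ hpos
  linarith [h x]

end Eigenvalues

/-! ### Functional calculus on eigenvectors -/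

lemma aeval_apply_of_apply_eq_smul {A : H →L[ℂ] H} {x : H} {r : ℝ} (hx : A x = (r : ℂ) • x)
    (P : Polynomial ℝ) : Polynomial.aeval A P x = ((P.eval r : ℝ) : ℂ) • x := by
  induction P using Polynomial.induction_on' with
  | add P Q hP hQ => simp [hP, hQ, add_smul]
  | monomial n a =>
    have hpow : ∀ n : ℕ, (A ^ n) x = ((r ^ n : ℝ) : ℂ) • x := by
      intro n
      induction n with
      | zero => simp
      | succ n ih =>
        rw [pow_succ, mul_apply_eq_comp, hx, map_smul, ih, smul_smul]
        push_cast
        rw [pow_succ, mul_comm]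
    rw [Polynomial.aeval_monomial, ← Algebra.smul_def, _root_.smul_apply, hpow,
      Polynomial.eval_monomial, ← Complex.coe_smul a, smul_smul]
    push_cast
    rfl

/-- The spectrum is finite, so `f` agrees on it with a Lagrange interpolation polynomial, however
irregular `f` is. -/
lemma cfc_apply_of_apply_eq_smul [CompleteSpace H] [FiniteDimensional ℂ H] {A : H →L[ℂ] H}
    (hA : IsSelfAdjoint A) {x : H} {r : ℝ} (hx : A x = (r : ℂ) • x) (f : ℝ → ℝ) :
    cfc f A x = (f r : ℂ) • x := by
  classical
  rcases eq_or_ne x 0 with rfl | hx0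
  · simp
  have hspec : ∀ z : ℂ, z ∈ spectrum ℂ A ↔ z ∈ spectrum ℂ (A : H →ₗ[ℂ] H) := fun z => by
    rw [ContinuousLinearMap.spectrum_eq]
  have hfin : (spectrum ℝ A).Finite := by
    have h1 : (spectrum ℂ A).Finite := by
      rw [ContinuousLinearMap.spectrum_eq]
      exact Module.End.finite_spectrum _
    rw [← spectrum.preimage_algebraMap ℂ]
    exact h1.preimage (FaithfulSMul.algebraMap_injective ℝ ℂ).injOn
  have hr : r ∈ spectrum ℝ A := by
    rw [← spectrum.preimage_algebraMap ℂ, Set.mem_preimage, hspec]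
    exact (Module.End.hasEigenvalue_of_hasEigenvector
      ⟨Module.End.mem_eigenspace_iff.2 hx, hx0⟩).mem_spectrum
  set P := Lagrange.interpolate hfin.toFinset id f with hP
  have hev : ∀ s ∈ spectrum ℝ A, P.eval s = f s := fun s hs =>
    Lagrange.eval_interpolate_at_node (v := id) f Function.injective_id.injOn
      (hfin.mem_toFinset.2 hs)
  rw [cfc_congr (g := P.eval) fun s hs => (hev s hs).symm, cfc_polynomial P A hA,
    aeval_apply_of_apply_eq_smul hx, hev r hr]

/-! ### Operators diagonal in an orthonormal basis -/

section Diagonal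

variable {ι : Type*} [Fintype ι] (b : OrthonormalBasis ι ℂ H)

lemma trace_eq_sum_of_apply_eq_smul {A : H →L[ℂ] H} {v : ι → ℂ}
    (hA : ∀ i, A (b i) = v i • b i) : trace A = ∑ i, v i := by
  rw [trace, LinearMap.trace_eq_sum_inner _ b]
  refine sum_congr rfl fun i _ => ?_
  simp [hA, inner_smul_right]

/-- The operator with eigenvalues `v i` on the orthonormal basis `b`. -/
noncomputable def diagonalOp (v : ι → ℝ) : H →L[ℂ] H :=
  ∑ i, (v i : ℂ) • InnerProductSpace.rankOne ℂ (b i) (b i)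

lemma diagonalOp_apply (v : ι → ℝ) (x : H) :
    diagonalOp b v x = ∑ i, ((v i : ℂ) * inner ℂ (b i) x) • b i := by
  simp [diagonalOp, mul_smul]

lemma diagonalOp_apply_basis (v : ι → ℝ) (i : ι) :
    diagonalOp b v (b i) = (v i : ℂ) • b i := by
  classical
  simp [diagonalOp_apply, b.inner_eq_ite, ite_smul]

lemma diagonalOp_sub (v w : ι → ℝ) : diagonalOp b (v - w) = diagonalOp b v - diagonalOp b w := by
  simp [diagonalOp, sub_smul]

lemma diagonalOp_isPositive {v : ι → ℝ} (hv : ∀ i, 0 ≤ v i) : (diagonalOp b v).IsPositive :=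
  ContinuousLinearMap.isPositive_sum _ fun i _ =>
    (InnerProductSpace.isPositive_rankOne_self (b i)).smul_of_nonneg (by exact_mod_cast hv i)

lemma diagonalOp_isState {v : ι → ℝ} (hv : ∀ i, 0 ≤ v i) (hv1 : ∑ i, v i = 1) :
    IsState (diagonalOp b v) :=
  ⟨diagonalOp_isPositive b hv, by
    rw [trace_eq_sum_of_apply_eq_smul b (diagonalOp_apply_basis b v)]; exact_mod_cast hv1⟩

lemma norm_diagonalOp_le {v : ι → ℝ} {ν : ℝ} (hν : 0 ≤ ν) (hv : ∀ i, |v i| ≤ ν) :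
    ‖diagonalOp b v‖ ≤ ν := by
  refine ContinuousLinearMap.opNorm_le_bound _ hν fun x => ?_
  refine le_of_sq_le_sq ?_ (by positivity)
  rw [mul_pow, ← b.sum_sq_norm_inner_right, ← b.sum_sq_norm_inner_right x, mul_sum]
  refine sum_le_sum fun i _ => ?_
  rw [diagonalOp_apply, b.orthonormal.inner_right_fintype, norm_mul, mul_pow]
  gcongr
  simpa using hv i

lemma le_norm_diagonalOp (v : ι → ℝ) (i : ι) : |v i| ≤ ‖diagonalOp b v‖ := by
  have := (diagonalOp b v).le_opNorm (b i)
  simpa [diagonalOp_apply_basis, norm_smul] using this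

variable [CompleteSpace H] [FiniteDimensional ℂ H]

lemma vonNeumannEntropy_eq_sum {A : H →L[ℂ] H} (hsa : IsSelfAdjoint A) {v : ι → ℝ}
    (hA : ∀ i, A (b i) = (v i : ℂ) • b i) :
    vonNeumannEntropy A = (∑ i, negMulLog (v i)) / log 2 := by
  have h : ∀ i, (A * cfc (logb 2) A) (b i) = ((v i * logb 2 (v i) : ℝ) : ℂ) • b i := by
    intro i
    rw [mul_apply_eq_comp, cfc_apply_of_apply_eq_smul hsa (hA i), map_smul, hA,
      smul_smul]
    push_cast
    rw [mul_comm]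
  rw [vonNeumannEntropy, trace_eq_sum_of_apply_eq_smul b h, Complex.re_sum, sum_div,
    ← sum_neg_distrib]
  refine sum_congr rfl fun i _ => ?_
  rw [Complex.ofReal_re, negMulLog, logb]
  ring

lemma traceNorm_eq_sum {A : H →L[ℂ] H} (hsa : IsSelfAdjoint A) {v : ι → ℝ}
    (hA : ∀ i, A (b i) = (v i : ℂ) • b i) : traceNorm A = ∑ i, |v i| := by
  have h : ∀ i, (CFC.abs A) (b i) = ((|v i| : ℝ) : ℂ) • b i := by
    intro i
    rw [CFC.abs_eq_cfc_norm A hsa, cfc_apply_of_apply_eq_smul hsa (hA i), Real.norm_eq_abs]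
  rw [traceNorm, trace_eq_sum_of_apply_eq_smul b h, Complex.re_sum]
  rfl

end Diagonal

end

/-! ### The continuity bound -/

lemma mul_logb_add_binaryEntropy (ε x : ℝ) :
    ε * logb 2 x + binaryEntropy ε = (ε * log x + binEntropy ε) / log 2 := by
  rw [binEntropy_eq_negMulLog_add_negMulLog_one_sub, binaryEntropy, negMulLog, negMulLog]
  simp only [logb]
  ring

section

variable {H : Type*} [NormedAddCommGroup H] [InnerProductSpace ℂ H]

lemma re_trace_add (A B : H →L[ℂ] H) : (trace (A + B)).re = (trace A).re + (trace B).re := by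
  simp [trace]

/-- The witness `A + (A - B)⁻ = B + (A - B)⁺` is a common upper bound. Its eigenvalues dominate
those of both operators, which yields Mirsky's inequality termwise. -/
lemma exists_ge_ge_traceNorm_sub_eq [CompleteSpace H] {A B : H →L[ℂ] H} (hA : IsSelfAdjoint A)
    (hB : IsSelfAdjoint B) :
    ∃ C : H →L[ℂ] H, IsSelfAdjoint C ∧ A ≤ C ∧ B ≤ C ∧
      traceNorm (A - B) = 2 * (trace C).re - (trace A).re - (trace B).re := by
  have hsa : IsSelfAdjoint (A - B) := hA.sub hB
  have hC : A + (A - B)⁻ = B + (A - B)⁺ := by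
    rw [add_comm B]
    exact (sub_eq_sub_iff_add_eq_add.1 (CFC.posPart_sub_negPart (A - B) hsa)).symm
  have hneg : 0 ≤ (A - B)⁻ := CFC.negPart_nonneg _
  have hpos : 0 ≤ (A - B)⁺ := CFC.posPart_nonneg _
  refine ⟨A + (A - B)⁻, hA.add (IsSelfAdjoint.of_nonneg hneg), le_add_of_nonneg_right hneg, ?_, ?_⟩
  · rw [hC]
    exact le_add_of_nonneg_right hpos
  · have h1 : (trace (A + (A - B)⁻)).re = (trace B).re + (trace (A - B)⁺).re := by
      rw [hC, re_trace_add]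
    have h2 := re_trace_add A (A - B)⁻
    rw [traceNorm, ← CFC.posPart_add_negPart (A - B) hsa, re_trace_add]
    linarith

variable [FiniteDimensional ℂ H] {d : ℕ}

lemma re_trace_eq_sum_eigenvalues {A : H →L[ℂ] H} (hA : (A : H →ₗ[ℂ] H).IsSymmetric)
    (hd : Module.finrank ℂ H = d) : (trace A).re = ∑ i, hA.eigenvalues hd i := by
  rw [trace_eq_sum_of_apply_eq_smul (hA.eigenvectorBasis hd) (hA.apply_eigenvectorBasis hd),
    Complex.re_sum]
  rfl

lemma eigenvalues_le_eigenvalues {A B : H →L[ℂ] H} (hA : (A : H →ₗ[ℂ] H).IsSymmetric)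
    (hB : (B : H →ₗ[ℂ] H).IsSymmetric) (hd : Module.finrank ℂ H = d) (hAB : A ≤ B) (i : Fin d) :
    hA.eigenvalues hd i ≤ hB.eigenvalues hd i := by
  have h := eigenvalues_le_add hA hB hd (c := 0) (fun x => ?_) i
  · rwa [add_zero] at h
  · have := (ContinuousLinearMap.le_def A B).1 hAB |>.re_inner_nonneg_left x
    simp only [sub_apply, inner_sub_left, map_sub, RCLike.re_to_complex, sub_nonneg] at this
    simpa using this

lemma eigenvalues_sub_le_norm {A B : H →L[ℂ] H} (hA : (A : H →ₗ[ℂ] H).IsSymmetric)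
    (hB : (B : H →ₗ[ℂ] H).IsSymmetric) (hd : Module.finrank ℂ H = d) (i : Fin d) :
    hA.eigenvalues hd i - hB.eigenvalues hd i ≤ ‖A - B‖ := by
  rw [sub_le_iff_le_add']
  refine eigenvalues_le_add hA hB hd (fun x => ?_) i
  have h1 : (inner ℂ ((A - B) x) x).re ≤ ‖(A - B) x‖ * ‖x‖ :=
    (Complex.re_le_norm _).trans (norm_inner_le_norm _ _)
  have h2 : ‖(A - B) x‖ * ‖x‖ ≤ ‖A - B‖ * ‖x‖ ^ 2 := by
    rw [sq, ← mul_assoc]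
    exact mul_le_mul_of_nonneg_right ((A - B).le_opNorm x) (norm_nonneg x)
  have h3 := h1.trans h2
  rw [sub_apply, inner_sub_left, Complex.sub_re] at h3
  simp only [ContinuousLinearMap.coe_coe]
  linarith

variable [CompleteSpace H]

/-- Mirsky's inequality for the trace norm. -/
theorem sum_abs_eigenvalues_sub_le_traceNorm {A B : H →L[ℂ] H}
    (hA : (A : H →ₗ[ℂ] H).IsSymmetric) (hB : (B : H →ₗ[ℂ] H).IsSymmetric)
    (hd : Module.finrank ℂ H = d) :
    ∑ i, |hA.eigenvalues hd i - hB.eigenvalues hd i| ≤ traceNorm (A - B) := by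
  obtain ⟨C, hC, hAC, hBC, htr⟩ := exists_ge_ge_traceNorm_sub_eq
    (ContinuousLinearMap.isSelfAdjoint_iff_isSymmetric.2 hA)
    (ContinuousLinearMap.isSelfAdjoint_iff_isSymmetric.2 hB)
  have hC' := ContinuousLinearMap.isSelfAdjoint_iff_isSymmetric.1 hC
  rw [htr, re_trace_eq_sum_eigenvalues hC' hd, re_trace_eq_sum_eigenvalues hA hd,
    re_trace_eq_sum_eigenvalues hB hd, mul_sum, ← sum_sub_distrib, ← sum_sub_distrib]
  refine sum_le_sum fun i _ => ?_
  have h1 := eigenvalues_le_eigenvalues hA hC' hd hAC i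
  have h2 := eigenvalues_le_eigenvalues hB hC' hd hBC i
  rw [abs_le]
  constructor <;> linarith

theorem abs_vonNeumannEntropy_sub_le {ρ σ : H →L[ℂ] H} (hρ : IsState ρ) (hσ : IsState σ)
    (hd : Module.finrank ℂ H = d) {ε ν : ℝ} (hε0 : 0 ≤ ε) (hν0 : 0 ≤ ν)
    (hT : traceDist ρ σ ≤ ε) (hN : ‖ρ - σ‖ ≤ ν) (hε : ε ≤ ν * d / (ν * d + 3)) :
    |vonNeumannEntropy ρ - vonNeumannEntropy σ| ≤
      ε * logb 2 (ν / ε * d - 1) + binaryEntropy ε := by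
  have hsρ := hρ.isPositive.isSymmetric
  have hsσ := hσ.isPositive.isSymmetric
  have hnonneg : ∀ {τ : H →L[ℂ] H} (hτ : IsState τ) (i : Fin d),
      0 ≤ hτ.isPositive.isSymmetric.eigenvalues hd i := fun hτ i =>
    ((ContinuousLinearMap.isPositive_toLinearMap_iff _).2 hτ.isPositive).nonneg_eigenvalues hd i
  have hsum : ∀ {τ : H →L[ℂ] H} (hτ : IsState τ),
      ∑ i, hτ.isPositive.isSymmetric.eigenvalues hd i = 1 := fun hτ => by
    rw [← re_trace_eq_sum_eigenvalues, hτ.trace_eq_one, Complex.one_re]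
  have hdiff : ∑ i, |hsρ.eigenvalues hd i - hsσ.eigenvalues hd i| ≤ 2 * ε := by
    refine (sum_abs_eigenvalues_sub_le_traceNorm hsρ hsσ hd).trans ?_
    rw [traceDist] at hT
    linarith
  have hle : ∀ i, |hsρ.eigenvalues hd i - hsσ.eigenvalues hd i| ≤ ν := fun i => by
    refine le_trans ?_ hN
    rw [abs_le']
    refine ⟨eigenvalues_sub_le_norm hsρ hsσ hd i, ?_⟩
    rw [neg_sub, norm_sub_rev]
    exact eigenvalues_sub_le_norm hsσ hsρ hd i
  rw [vonNeumannEntropy_eq_sum (hsρ.eigenvectorBasis hd) hρ.isPositive.isSelfAdjoint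
      (hsρ.apply_eigenvectorBasis hd),
    vonNeumannEntropy_eq_sum (hsσ.eigenvectorBasis hd) hσ.isPositive.isSelfAdjoint
      (hsσ.apply_eigenvectorBasis hd), ← sub_div, mul_logb_add_binaryEntropy, abs_div,
    abs_of_pos (log_pos one_lt_two)]
  have hlog : 0 ≤ log 2 := (log_pos one_lt_two).le
  gcongr
  have := abs_sum_negMulLog_sub_le (hnonneg hρ) (hnonneg hσ) (hsum hρ) (hsum hσ) hle hdiff hε0 hν0
    (by simpa using hε)
  simpa using this

end

/-! ### Tightness -/

lemma sum_fin_ite_lt {d n : ℕ} (hn : n ≤ d) (a b : ℝ) :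
    ∑ i : Fin d, (if (i : ℕ) < n then a else b) = n * a + (d - n) * b := by
  obtain ⟨m, rfl⟩ := Nat.exists_eq_add_of_le hn
  rw [Fin.sum_univ_add]
  simp

lemma mul_negMulLog_div {c : ℝ} (hc : c ≠ 0) (x : ℝ) :
    c * negMulLog (x / c) = negMulLog x + x * log c := by
  rcases eq_or_ne x 0 with rfl | hx
  · simp
  · rw [negMulLog, negMulLog, log_div hx hc]
    field_simp
    ring

theorem exists_isState_vonNeumannEntropy_sub_eq {H : Type*} [NormedAddCommGroup H]
    [InnerProductSpace ℂ H] [CompleteSpace H] [FiniteDimensional ℂ H] {d n : ℕ}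
    (hd : Module.finrank ℂ H = d) (hn : 0 < n) (hnd : 2 * n ≤ d) {ε : ℝ} (hε0 : 0 ≤ ε)
    (hε1 : ε ≤ 1) :
    ∃ ρ σ : H →L[ℂ] H, IsState ρ ∧ IsState σ ∧ traceDist ρ σ = ε ∧ ‖ρ - σ‖ = ε / n ∧
      |vonNeumannEntropy ρ - vonNeumannEntropy σ| =
        ε * logb 2 (d / n - 1) + binaryEntropy ε := by
  have hn0 : (0 : ℝ) < n := by exact_mod_cast hn
  have hnd' : 2 * (n : ℝ) ≤ d := by exact_mod_cast hnd
  have hm0 : (0 : ℝ) < d - n := by linarith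
  have hle : n ≤ d := by omega
  let b : OrthonormalBasis (Fin d) ℂ H := (stdOrthonormalBasis ℂ H).reindex (finCongr hd)
  let v : Fin d → ℝ := fun i => if (i : ℕ) < n then (1 - ε) / n else ε / (d - n)
  let w : Fin d → ℝ := fun i => if (i : ℕ) < n then 1 / n else 0
  have hv0 : ∀ i, 0 ≤ v i := fun i => by
    simp only [v]
    have : 0 ≤ 1 - ε := by linarith
    split_ifs <;> positivity
  have hw0 : ∀ i, 0 ≤ w i := fun i => by
    simp only [w]
    split_ifs <;> positivity
  have hv1 : ∑ i, v i = 1 := by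
    rw [sum_fin_ite_lt hle]; field_simp; ring
  have hw1 : ∑ i, w i = 1 := by
    rw [sum_fin_ite_lt hle]; field_simp; ring
  have hvw : ∀ i, |(v - w) i| = if (i : ℕ) < n then ε / n else ε / (d - n) := fun i => by
    simp only [v, w, Pi.sub_apply]
    split_ifs
    · rw [← sub_div, sub_sub_cancel_left, neg_div, abs_neg, abs_of_nonneg (by positivity)]
    · rw [sub_zero, abs_of_nonneg (by positivity)]
  have hsv := (diagonalOp_isPositive b hv0).isSelfAdjoint
  have hsw := (diagonalOp_isPositive b hw0).isSelfAdjoint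
  have hS : ∀ u : Fin d → ℝ, (∀ i, 0 ≤ u i) → vonNeumannEntropy (diagonalOp b u) =
      (∑ i, negMulLog (u i)) / log 2 := fun u hu =>
    vonNeumannEntropy_eq_sum b (diagonalOp_isPositive b hu).isSelfAdjoint
      (diagonalOp_apply_basis b u)
  refine ⟨diagonalOp b v, diagonalOp b w, diagonalOp_isState b hv0 hv1,
    diagonalOp_isState b hw0 hw1, ?_, ?_, ?_⟩
  · rw [traceDist, ← diagonalOp_sub, traceNorm_eq_sum b (diagonalOp_sub b v w ▸ hsv.sub hsw)
      (diagonalOp_apply_basis b _), sum_congr rfl fun i _ => hvw i, sum_fin_ite_lt hle]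
    field_simp
    ring
  · rw [← diagonalOp_sub]
    refine le_antisymm (norm_diagonalOp_le b (by positivity) fun i => ?_) ?_
    · rw [hvw]
      split_ifs
      · exact le_rfl
      -- `2 * n ≤ d` makes `ε / n` the largest entry of the difference.
      · exact div_le_div_of_nonneg_left hε0 hn0 (by linarith)
    · have h := le_norm_diagonalOp b (v - w) ⟨0, by omega⟩
      rwa [hvw, if_pos hn] at h
  · have hlog : log (d / n - 1) = log (d - n) - log n := by
      rw [← log_div hm0.ne' hn0.ne']; congr 1; field_simp
    have hge : 0 ≤ log ((d : ℝ) / n - 1) := by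
      refine log_nonneg ?_
      have : 2 ≤ (d : ℝ) / n := by rwa [le_div_iff₀ hn0]
      linarith
    have hEv : ∑ i, negMulLog (v i) =
        negMulLog (1 - ε) + (1 - ε) * log n + (negMulLog ε + ε * log (d - n)) := by
      simp only [v, apply_ite negMulLog]
      rw [sum_fin_ite_lt hle, mul_negMulLog_div hn0.ne', mul_negMulLog_div hm0.ne']
    have hEw : ∑ i, negMulLog (w i) = log n := by
      simp only [w, apply_ite negMulLog]
      rw [sum_fin_ite_lt hle, mul_negMulLog_div hn0.ne']
      simp
    rw [hS v hv0, hS w hw0, mul_logb_add_binaryEntropy, ← sub_div]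
    have heq : ∑ i, negMulLog (v i) - ∑ i, negMulLog (w i) =
        ε * log (d / n - 1) + binEntropy ε := by
      rw [hEv, hEw, hlog, binEntropy_eq_negMulLog_add_negMulLog_one_sub]
      ring
    rw [heq, abs_of_nonneg]
    exact div_nonneg (add_nonneg (mul_nonneg hε0 hge) (binEntropy_nonneg hε0 hε1))
      (log_pos one_lt_two).le

end QEntropy

theorem mainTheorem2 {H : Type*} [NormedAddCommGroup H] [InnerProductSpace ℂ H]
    [CompleteSpace H] [FiniteDimensional ℂ H] (d : ℕ) (hd : Module.finrank ℂ H = d) :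
    -- the continuity bound
    (∀ (ρ σ : H →L[ℂ] H), QEntropy.IsState ρ → QEntropy.IsState σ →
      ∀ ε ∈ Set.Icc (0 : ℝ) 1, ∀ ν ∈ Set.Icc (0 : ℝ) 1,
        QEntropy.traceDist ρ σ ≤ ε → ‖ρ - σ‖ ≤ ν → ε ≤ ν * d / (ν * d + 3) →
        ∀ β : ℝ, β = ν / ε →
          |QEntropy.vonNeumannEntropy ρ - QEntropy.vonNeumannEntropy σ| ≤
            ε * Real.logb 2 (β * d - 1) + QEntropy.binaryEntropy ε) ∧
    -- the bound is attained for all admissible parameters with `1 / β` an integer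
    (∀ ε ∈ Set.Icc (0 : ℝ) 1, ∀ ν ∈ Set.Icc (0 : ℝ) 1,
      0 < ε → ε ≤ ν * d / (ν * d + 3) →
      ∀ β : ℝ, β = ν / ε → (∃ n : ℤ, 1 / β = n) →
        ∃ ρ σ : H →L[ℂ] H, QEntropy.IsState ρ ∧ QEntropy.IsState σ ∧
          QEntropy.traceDist ρ σ = ε ∧ ‖ρ - σ‖ = ν ∧
          |QEntropy.vonNeumannEntropy ρ - QEntropy.vonNeumannEntropy σ| =
            ε * Real.logb 2 (β * d - 1) + QEntropy.binaryEntropy ε) := by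
  refine ⟨fun ρ σ hρ hσ ε hε ν hν hT hN hle β hβ => ?_, fun ε hε ν hν hε0 hle β hβ hint => ?_⟩
  · rw [hβ]
    exact QEntropy.abs_vonNeumannEntropy_sub_le hρ hσ hd hε.1 hν.1 hT hN hle
  · obtain ⟨k, hk⟩ := hint
    have hνd : 0 ≤ ν * d := mul_nonneg hν.1 (Nat.cast_nonneg d)
    rw [le_div_iff₀ (by linarith)] at hle
    have hν0 : 0 < ν := by
      rcases hν.1.eq_or_lt with h | h
      · rw [← h] at hle; linarith
      · exact h
    rw [hβ, one_div_div] at hk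
    have hk0 : 0 < k := by
      have : (0 : ℝ) < k := hk ▸ div_pos hε0 hν0
      exact_mod_cast this
    lift k to ℕ using hk0.le
    rw [Int.cast_natCast] at hk
    have hk0' : (0 : ℝ) < k := by exact_mod_cast hk0
    have hεk : ε = k * ν := by rw [← hk, div_mul_cancel₀ _ hν0.ne']
    have hdk : 2 * (k : ℝ) ≤ d := by
      rw [hεk] at hle
      -- The constraint on `ε` gives `3 * k ≤ d`, more than is needed.
      have : ν * (k * 3) ≤ ν * d := by nlinarith [mul_nonneg (mul_nonneg hk0'.le hν0.le) hνd]
      linarith [le_of_mul_le_mul_left this hν0]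
    have hνeq : ε / k = ν := by rw [hεk]; field_simp
    have hβd : β * d = d / k := by rw [hβ, hεk]; field_simp
    rw [hβd, ← hνeq]
    exact QEntropy.exists_isState_vonNeumannEntropy_sub_eq hd (by exact_mod_cast hk0)
      (by exact_mod_cast hdk) hε.1 hε.2
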